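/- Let $n\ge 1$. All finite dimensional spaces carry the Euclidean norm $|\cdot|$ (the Frobenius norm for matrices), and $V(z):=\sqrt{1+|z|^{2}}-1$. A *standard mollifier* is a radial function $\rho\colon\mathbb R^{n}\to[0,\infty)$ with $\int_{\mathbb R^n}\rho\,\mathrm dx=1$ and $\operatorname{spt}\rho\subset\overline{B(0,1)}$ that is of class $C^{\infty}$ in $B(0,1)$; for $\varepsilon>0$ put $\rho_{\varepsilon}(x):=\varepsilon^{-n}\rho(x/\varepsilon)$. The space $BD_{\mathrm{loc}}(\mathbb R^{n})$ consists of all $u\in L^{1}_{\mathrm{loc}}(\mathbb R^{n};\mathbb R^{n})$ whose distributional symmetric gradient $Eu=\frac12(Du+Du^{\mathsf T})$ is a locally finite $\mathbb R^{n\times n}_{\mathrm{sym}}$-valued Radon measure. With the Lebesgue decomposition $Eu=\mathscr E u\,\mathscr L^{n}+E^{s}u$ and the recession function $V^{\infty}(\xi)=\lim_{t\searrow0}tV(\xi/t)=|\xi|$, put for Borel sets $A$ $$\int_{A}V(Eu):=\int_{A}V(\mathscr E u)\,\mathrm dx+\int_{A}V^{\infty}\Big(\frac{\mathrm dE^{s}u}{\mathrm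 d|E^{s}u|}\Big)\,\mathrm d|E^{s}u| .$$ **Proposition.** Let $\lambda>1$. There exists a constant $c=c(n,\lambda)>0$ such that for every open and bounded set $\Omega\subset\mathbb R^{n}$ with Lipschitz boundary, every $u\in BD_{\mathrm{loc}}(\mathbb R^{n})$, all $\varepsilon,L>0$ and every standard mollifier $\rho$, $$\int_{\Omega}V\big(L(u-\rho_{\varepsilon}*u)\big)\,\mathrm dx\;\le\;c\,\max\{L\varepsilon,(L\varepsilon)^{2}\}\int_{\overline{\Omega+B(0,\lambda\sqrt n\,\varepsilon)}}V(Eu).$$ -/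

import Mathlib

open MeasureTheory Filter Topology
open scoped ENNReal NNReal ContDiff Pointwise Convolution

noncomputable section

namespace ConvPoincare

/-- The Euclidean space `ℝⁿ`. -/
abbrev Vec (n : ℕ) : Type := EuclideanSpace ℝ (Fin n)

/-- Real `n × n` matrices, indexed by pairs `(i, j)`. The Euclidean norm of this space is the
Frobenius norm. -/
abbrev Mat (n : ℕ) : Type := EuclideanSpace ℝ (Fin n × Fin n)

/-- The reference integrand `V(z) = √(1 + |z|²) - 1`. -/
def refV {F : Type*} [NormedAddCommGroup F] (z : F) : ℝ :=
  Real.sqrt (1 + ‖z‖ ^ 2) - 1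

/-- The recession function `h^∞(ξ) = lim_{t ↘ 0} t h(ξ / t)`. -/
def recession {F : Type*} [NormedAddCommGroup F] [NormedSpace ℝ F] (h : F → ℝ) (ξ : F) : ℝ :=
  limUnder (𝓝[>] (0 : ℝ)) (fun t : ℝ => t * h (t⁻¹ • ξ))

/-- An `ℝ^{n×n}_sym`-valued (locally finite) Radon measure `μ` on `ℝⁿ`, given by its polar
decomposition `μ = (dμ/d|μ|) |μ|`: a locally finite Borel measure `|μ|`, the total variation
measure, and a density `dμ/d|μ|` of Frobenius norm one. -/
structure SymRadonMeasure (n : ℕ) where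
  /-- The total variation measure `|μ|`. -/
  tv : Measure (Vec n)
  locallyFinite : IsLocallyFiniteMeasure tv
  /-- The density `dμ/d|μ|`. -/
  polar : Vec n → Mat n
  measurable_polar : Measurable polar
  norm_polar : ∀ᵐ x ∂tv, ‖polar x‖ = 1
  symm_polar : ∀ᵐ x ∂tv, ∀ i j : Fin n, polar x (i, j) = polar x (j, i)

/-- The function of a measure
`∫_A h(μ) = ∫_A h(dμ/dℒⁿ) dℒⁿ + ∫_A h^∞(dμˢ/d|μˢ|) d|μˢ|` for `h ≥ 0`.
In terms of the polar decomposition, `dμ/dℒⁿ = (d|μ|/dℒⁿ) (dμ/d|μ|)`, the measure `|μˢ|` is the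
singular part of `|μ|`, and `dμˢ/d|μˢ| = dμ/d|μ|` holds `|μˢ|`-almost everywhere. -/
def SymRadonMeasure.funInt {n : ℕ} (h : Mat n → ℝ) (μ : SymRadonMeasure n) (A : Set (Vec n)) :
    ℝ≥0∞ :=
  (∫⁻ x in A, ENNReal.ofReal (h ((μ.tv.rnDeriv volume x).toReal • μ.polar x))) +
    ∫⁻ x in A, ENNReal.ofReal (recession h (μ.polar x)) ∂(μ.tv.singularPart volume)

/-- The partial derivative `∂ⱼψ`. -/
def partialDeriv {n : ℕ} (j : Fin n) (ψ : Vec n → ℝ) (x : Vec n) : ℝ :=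
  fderiv ℝ ψ x (EuclideanSpace.single j 1)

/-- The measure `μ` is the distributional symmetric gradient `E u = (Du + Duᵀ) / 2` of `u`
on `ℝⁿ`. -/
def IsSymGradient {n : ℕ} (u : Vec n → Vec n) (μ : SymRadonMeasure n) : Prop :=
  ∀ ψ : Vec n → ℝ, ContDiff ℝ ∞ ψ → HasCompactSupport ψ → ∀ i j : Fin n,
    ∫ x, (u x i * partialDeriv j ψ x + u x j * partialDeriv i ψ x) / 2 =
      -∫ x, ψ x * μ.polar x (i, j) ∂μ.tv

/-- The space `BD_loc(ℝⁿ)`: locally integrable maps whose distributional symmetric gradient is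
a locally finite Radon measure. -/
def MemBDLoc {n : ℕ} (u : Vec n → Vec n) : Prop :=
  LocallyIntegrable u volume ∧ ∃ μ : SymRadonMeasure n, IsSymGradient u μ

/-- Open and bounded sets with Lipschitz boundary: close to each boundary point, the set is the
strict epigraph of a Lipschitz function, in the direction of some unit vector `ν`, over the
hyperplane orthogonal to `ν`. -/
structure IsBoundedLipschitzDomain {n : ℕ} (Ω : Set (Vec n)) : Prop where
  isOpen : IsOpen Ω
  isBounded : Bornology.IsBounded Ω
  lipschitz_boundary : ∀ x ∈ frontier Ω, ∃ ν : Vec n, ‖ν‖ = 1 ∧ ∃ r : ℝ, 0 < r ∧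
    ∃ (K : ℝ≥0) (g : Vec n → ℝ), LipschitzWith K g ∧
      ∀ y ∈ Metric.ball x r,
        (y ∈ Ω ↔ g (y - (inner ℝ ν y : ℝ) • ν) < (inner ℝ ν y : ℝ))

/-- Standard mollifiers: radial, nonnegative functions of integral one, supported in the closed
unit ball and smooth in the open unit ball (but possibly discontinuous across the sphere). -/
structure IsStandardMollifier {n : ℕ} (ρ : Vec n → ℝ) : Prop where
  nonneg : ∀ x, 0 ≤ ρ x
  radial : ∀ x y, ‖x‖ = ‖y‖ → ρ x = ρ y
  tsupport_subset : tsupport ρ ⊆ Metric.closedBall 0 1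
  smooth : ContDiffOn ℝ ∞ ρ (Metric.ball 0 1)
  integral_eq_one : ∫ x, ρ x = 1

/-- The rescaled mollifier `ρ_ε(x) = ε^{-n} ρ(x / ε)`. -/
def rescale {n : ℕ} (ρ : Vec n → ℝ) (ε : ℝ) (x : Vec n) : ℝ :=
  (ε ^ n)⁻¹ * ρ (ε⁻¹ • x)

/-- The mollification `ρ_ε * u`. -/
def mollify {n : ℕ} (ρ : Vec n → ℝ) (ε : ℝ) (u : Vec n → Vec n) : Vec n → Vec n :=
  rescale ρ ε ⋆[ContinuousLinearMap.lsmul ℝ ℝ, volume] u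

end ConvPoincare

end

/-! A radial kernel averages symmetrically, so `u - ρ_ε * u` is `-1/2` times the `ρ_ε`-average over
`|y| ≤ ε` of the second differences `u(x+y) + u(x-y) - 2u(x)`. These vanish on affine maps, and the
symmetric gradient alone controls them. For a `C¹` field `v`, the number `(v(Q) - v(P)) · (Q - P)`
is the integral along the segment of `⟨Dv d, d⟩` with `d = Q - P`, and this quadratic form sees only
the symmetric part of `Dv` (`abs_inner_sub_le`). The component along `w` of a second difference is a
combination of six such numbers, taken along the sides of the parallelogram with vertices `x ± y`,
`x ± w` and along the segments from `x` to `x ± w` (`inner_secondDiff_eq`).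

With `w = ε eᵢ`, the second difference is bounded by `2ε` times a sum of `6n` segment means of
`|Ev|`. Jensen's inequality moves `V` inside the means, translation invariance turns each into an
integral of `V(Ev)` over an `ε`-neighbourhood, and `V(sz) ≤ max(s, s²) V(z)` produces the factor in
`Lε`.

For `u` in `BD_loc`, smooth by bumps `φ_k`. Since `E(φ_k * u) = φ_k * Eu`, smoothing does not
increase `∫ V(Eu)` apart from a small enlargement of the set (`lintegral_symGrad_convolution_le`).
As `φ_k *` commutes with `ρ_ε *`, almost everywhere convergence and Fatou's lemma give the general
case. -/

noncomputable section

namespace ConvPoincare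

/-! ### Growth, convexity and recession of the integrand `V` -/

section RefV

variable {F F' : Type*} [NormedAddCommGroup F] [NormedAddCommGroup F']

theorem refV_nonneg (z : F) : 0 ≤ refV z := by
  have : (1 : ℝ) ≤ Real.sqrt (1 + ‖z‖ ^ 2) := Real.one_le_sqrt.2 (by nlinarith [sq_nonneg ‖z‖])
  unfold refV; linarith

theorem refV_zero : refV (0 : F) = 0 := by simp [refV]

theorem refV_mono {z : F} {z' : F'} (h : ‖z‖ ≤ ‖z'‖) : refV z ≤ refV z' := by
  unfold refV
  gcongr

theorem refV_norm (z : F) : refV ‖z‖ = refV z := by simp [refV]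

theorem continuous_refV : Continuous (refV : F → ℝ) := by
  unfold refV
  fun_prop

theorem refV_le_norm (z : F) : refV z ≤ ‖z‖ := by
  have : Real.sqrt (1 + ‖z‖ ^ 2) ≤ 1 + ‖z‖ :=
    Real.sqrt_le_iff.2 ⟨by positivity, by nlinarith [norm_nonneg z]⟩
  unfold refV; linarith

/-- `V` is 1-Lipschitz, with the slope of its recession function. This lets the singular part of
`Eu` be split off at the cost of its total variation. -/
theorem refV_add_le (a b : F) : refV (a + b) ≤ refV a + ‖b‖ := by
  have h1 : ‖a + b‖ ≤ ‖a‖ + ‖b‖ := norm_add_le a b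
  have ha : ‖a‖ ≤ Real.sqrt (1 + ‖a‖ ^ 2) := Real.le_sqrt_of_sq_le (by linarith)
  have hs := Real.sq_sqrt (show (0 : ℝ) ≤ 1 + ‖a‖ ^ 2 by positivity)
  have : Real.sqrt (1 + ‖a + b‖ ^ 2) ≤ Real.sqrt (1 + ‖a‖ ^ 2) + ‖b‖ := by
    refine Real.sqrt_le_iff.2 ⟨by positivity, ?_⟩
    have h2 : ‖a + b‖ ^ 2 ≤ (‖a‖ + ‖b‖) ^ 2 := by gcongr
    nlinarith [mul_le_mul_of_nonneg_right ha (norm_nonneg b)]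
  unfold refV; linarith

variable [NormedSpace ℝ F]

/-- `V + 1` is the Euclidean norm of the pair `(1, ‖z‖)`; `hst` is the Cauchy–Schwarz inequality for
two such pairs. -/
theorem convexOn_refV : ConvexOn ℝ Set.univ (refV : F → ℝ) := by
  refine ⟨convex_univ, fun x _ y _ a b ha hb hab => ?_⟩
  set s := Real.sqrt (1 + ‖x‖ ^ 2) with hs
  set t := Real.sqrt (1 + ‖y‖ ^ 2) with ht
  have hs2 : s ^ 2 = 1 + ‖x‖ ^ 2 := Real.sq_sqrt (by positivity)
  have ht2 : t ^ 2 = 1 + ‖y‖ ^ 2 := Real.sq_sqrt (by positivity)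
  have hst : 1 + ‖x‖ * ‖y‖ ≤ s * t := by
    rw [hs, ht, ← Real.sqrt_mul (by positivity)]
    exact Real.le_sqrt_of_sq_le (by nlinarith [sq_nonneg (‖x‖ - ‖y‖)])
  have hn : ‖a • x + b • y‖ ≤ a * ‖x‖ + b * ‖y‖ := by
    refine (norm_add_le _ _).trans_eq ?_
    rw [norm_smul, norm_smul, Real.norm_of_nonneg ha, Real.norm_of_nonneg hb]
  have key : Real.sqrt (1 + ‖a • x + b • y‖ ^ 2) ≤ a * s + b * t := by
    refine Real.sqrt_le_iff.2 ⟨by positivity, ?_⟩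
    have h2 : ‖a • x + b • y‖ ^ 2 ≤ (a * ‖x‖ + b * ‖y‖) ^ 2 := by gcongr
    have h3 : a * b * (1 + ‖x‖ * ‖y‖) ≤ a * b * (s * t) := by gcongr
    have h4 : (1 : ℝ) = (a + b) ^ 2 := by rw [hab]; norm_num
    calc 1 + ‖a • x + b • y‖ ^ 2 ≤ (a + b) ^ 2 + (a * ‖x‖ + b * ‖y‖) ^ 2 := by linarith
      _ ≤ a ^ 2 * (1 + ‖x‖ ^ 2) + b ^ 2 * (1 + ‖y‖ ^ 2) + 2 * (a * b * (s * t)) := by nlinarith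
      _ = (a * s + b * t) ^ 2 := by rw [← hs2, ← ht2]; ring
  simp only [refV, smul_eq_mul]
  rw [← hs, ← ht]
  nlinarith

theorem refV_smul_le {s : ℝ} (hs : 0 ≤ s) (z : F) :
    refV (s • z) ≤ max s (s ^ 2) * refV z := by
  rcases le_total s 1 with h | h
  · have := (convexOn_refV (F := F)).2 (Set.mem_univ z) (Set.mem_univ 0) hs
      (sub_nonneg.2 h) (by ring)
    simp only [smul_zero, add_zero, refV_zero, smul_eq_mul, mul_zero] at this
    exact this.trans (mul_le_mul_of_nonneg_right (le_max_left _ _) (refV_nonneg z))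
  · refine le_trans ?_ (mul_le_mul_of_nonneg_right (le_max_right _ _) (refV_nonneg z))
    simp only [refV, norm_smul, Real.norm_of_nonneg hs]
    set a := Real.sqrt (1 + ‖z‖ ^ 2) with ha
    have ha2 : a ^ 2 = 1 + ‖z‖ ^ 2 := Real.sq_sqrt (by positivity)
    have ha1 : 1 ≤ a := Real.one_le_sqrt.2 (by nlinarith [sq_nonneg ‖z‖])
    have hs1 : 1 ≤ s ^ 2 := by nlinarith
    rw [sub_le_iff_le_add]
    refine Real.sqrt_le_iff.2 ⟨by nlinarith, ?_⟩
    -- With `a² = 1 + ‖z‖²`, the right side minus the left side is exactly `s² (s² - 1) (a - 1)²`.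
    nlinarith [mul_nonneg (mul_nonneg (sub_nonneg.2 hs1) (sq_nonneg s)) (sq_nonneg (a - 1))]

theorem recession_refV (ξ : F) : recession refV ξ = ‖ξ‖ := by
  refine Tendsto.limUnder_eq ?_
  have h : Tendsto (fun t : ℝ => Real.sqrt (t ^ 2 + ‖ξ‖ ^ 2) - t) (𝓝[>] 0) (𝓝 ‖ξ‖) := by
    have : Continuous fun t : ℝ => Real.sqrt (t ^ 2 + ‖ξ‖ ^ 2) - t := by fun_prop
    have h0 := this.tendsto 0
    simp only [ne_eq, OfNat.ofNat_ne_zero, not_false_eq_true, zero_pow, zero_add,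
      Real.sqrt_sq (norm_nonneg ξ), sub_zero] at h0
    exact h0.mono_left nhdsWithin_le_nhds
  refine h.congr' ?_
  filter_upwards [self_mem_nhdsWithin] with t (ht : 0 < t)
  have : t ^ 2 + ‖ξ‖ ^ 2 = t ^ 2 * (1 + ‖t⁻¹ • ξ‖ ^ 2) := by
    rw [norm_smul, norm_inv, Real.norm_of_nonneg ht.le]; field_simp
  rw [this, Real.sqrt_mul (by positivity), Real.sqrt_sq ht.le, refV]
  ring

/-- A sum of `N` terms has a summand with at least the `N`-th part of its norm. -/
theorem refV_sum_le {ι : Type*} [Fintype ι] (a : ι → ℝ) (ha : ∀ i, 0 ≤ a i) :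
    refV (∑ i, a i) ≤ ∑ i, refV ((Fintype.card ι : ℝ) * a i) := by
  cases isEmpty_or_nonempty ι
  · simp [refV_zero]
  obtain ⟨j, -, hj⟩ := Finset.exists_max_image Finset.univ a Finset.univ_nonempty
  refine le_trans (refV_mono ?_) (Finset.single_le_sum
    (f := fun i => refV ((Fintype.card ι : ℝ) * a i)) (fun i _ => refV_nonneg _)
    (Finset.mem_univ j))
  rw [Real.norm_of_nonneg (Finset.sum_nonneg fun i _ => ha i),
    Real.norm_of_nonneg (mul_nonneg (Nat.cast_nonneg _) (ha j))]
  calc ∑ i, a i ≤ ∑ _i : ι, a j := Finset.sum_le_sum fun i hi => hj i hi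
    _ = _ := by simp

end RefV

/-! ### Jensen's inequality for `V` -/

section Jensen

variable {X F : Type*} [MeasurableSpace X] [NormedAddCommGroup F] [NormedSpace ℝ F]
  [CompleteSpace F]

theorem ofReal_refV_integral_le (μ : Measure X) [IsProbabilityMeasure μ] (f : X → F) :
    ENNReal.ofReal (refV (∫ x, f x ∂μ)) ≤ ∫⁻ x, ENNReal.ofReal (refV (f x)) ∂μ := by
  by_cases hf : Integrable f μ
  · have hV : Integrable (refV ∘ f) μ := by
      refine hf.mono (continuous_refV.comp_aestronglyMeasurable hf.1) (ae_of_all _ fun x => ?_)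
      rw [Function.comp_apply, Real.norm_of_nonneg (refV_nonneg _)]
      exact refV_le_norm _
    have h := convexOn_refV.map_integral_le continuous_refV.continuousOn isClosed_univ
      (by simp) hf hV
    refine (ENNReal.ofReal_le_ofReal h).trans_eq ?_
    exact ofReal_integral_eq_lintegral_ofReal hV (ae_of_all _ fun x => refV_nonneg _)
  -- Without integrability the Bochner integral is `0` and `V(0) = 0`, so no integrability
  -- assumption is needed.
  · simp [integral_undef hf, refV_zero]

theorem ofReal_refV_integral_smul_le (μ : Measure X) {w : X → ℝ} (hw : ∀ x, 0 ≤ w x)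
    (hw1 : ∫ x, w x ∂μ = 1) {f : X → F} (hf : AEStronglyMeasurable f μ) :
    ENNReal.ofReal (refV (∫ x, w x • f x ∂μ)) ≤
      ∫⁻ x, ENNReal.ofReal (w x) * ENNReal.ofReal (refV (f x)) ∂μ := by
  have hwi : Integrable w μ := by
    by_contra h
    rw [integral_undef h] at hw1
    exact zero_ne_one hw1
  have hwm : AEMeasurable (fun x => ENNReal.ofReal (w x)) μ := hwi.1.aemeasurable.ennreal_ofReal
  have : IsProbabilityMeasure (μ.withDensity fun x => ENNReal.ofReal (w x)) := by
    constructor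
    rw [withDensity_apply _ MeasurableSet.univ, Measure.restrict_univ,
      ← ofReal_integral_eq_lintegral_ofReal hwi (ae_of_all _ hw), hw1, ENNReal.ofReal_one]
  have h := ofReal_refV_integral_le (μ.withDensity fun x => ENNReal.ofReal (w x)) f
  rw [integral_withDensity_eq_integral_toReal_smul₀ hwm (by simp),
    lintegral_withDensity_eq_lintegral_mul₀ hwm
      (continuous_refV.comp_aestronglyMeasurable hf).aemeasurable.ennreal_ofReal] at h
  simpa only [ENNReal.toReal_ofReal (hw _), Pi.mul_apply, Function.comp_apply] using h

end Jensen

/-! ### Second differences of `C¹` fields controlled by the symmetric gradient -/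

variable {n : ℕ}

/-- The pointwise symmetric gradient of a differentiable map. -/
def symGrad (v : Vec n → Vec n) (x : Vec n) : Mat n :=
  WithLp.toLp 2 fun p => (fderiv ℝ v x (EuclideanSpace.single p.2 1) p.1 +
    fderiv ℝ v x (EuclideanSpace.single p.1 1) p.2) / 2

theorem continuous_symGrad {v : Vec n → Vec n} (hv : ContDiff ℝ 1 v) :
    Continuous (symGrad v) := by
  have h := hv.continuous_fderiv one_ne_zero
  unfold symGrad
  fun_prop

theorem clm_apply_eq_sum (A : Vec n →L[ℝ] Vec n) (d : Vec n) (i : Fin n) :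
    A d i = ∑ j, d j * A (EuclideanSpace.single j 1) i := by
  have h : d = ∑ j, d j • EuclideanSpace.single j (1 : ℝ) := by
    simpa using ((EuclideanSpace.basisFun (Fin n) ℝ).sum_repr d).symm
  conv_lhs => rw [h]
  simp

theorem norm_tensor_self (d : Vec n) :
    ‖(WithLp.toLp 2 fun p : Fin n × Fin n => d p.1 * d p.2 : Mat n)‖ = ‖d‖ ^ 2 := by
  rw [EuclideanSpace.norm_eq, EuclideanSpace.norm_sq_eq, Real.sqrt_eq_iff_mul_self_eq
    (by positivity) (by positivity), Finset.sum_mul_sum, Fintype.sum_prod_type]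
  simp [mul_pow]

/-- `⟨A d, d⟩` is the Frobenius product of `d ⊗ d` with the symmetric part of `A`, and `|d ⊗ d| =
|d|²`. -/
theorem abs_inner_fderiv_le (v : Vec n → Vec n) (x d : Vec n) :
    |inner ℝ (fderiv ℝ v x d) d| ≤ ‖d‖ ^ 2 * ‖symGrad v x‖ := by
  set T : Mat n := WithLp.toLp 2 fun p : Fin n × Fin n => d p.1 * d p.2 with hT
  have key : inner ℝ (fderiv ℝ v x d) d = inner ℝ T (symGrad v x) := by
    simp only [PiLp.inner_apply, hT, symGrad, Fintype.sum_prod_type, RCLike.inner_apply, conj_trivial,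
      clm_apply_eq_sum (fderiv ℝ v x) d, Finset.mul_sum]
    have h1 : ∀ a : Fin n → Fin n → ℝ, ∑ i, ∑ j, (a i j + a j i) / 2 = ∑ i, ∑ j, a i j := by
      intro a
      simp only [add_div, Finset.sum_add_distrib]
      rw [Finset.sum_comm (f := fun i j => a j i / 2), ← Finset.sum_add_distrib]
      simp_rw [← Finset.sum_add_distrib, add_halves]
    rw [← h1]
    refine Finset.sum_congr rfl fun i _ => Finset.sum_congr rfl fun j _ => by ring
  rw [key, ← norm_tensor_self d]
  exact abs_real_inner_le_norm _ _

/-- The mean value of `|Ev|` over the segment from `P` to `Q`. -/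
def segAvg (v : Vec n → Vec n) (P Q : Vec n) : ℝ :=
  ∫ t in Set.Icc (0 : ℝ) 1, ‖symGrad v (P + t • (Q - P))‖

theorem segAvg_nonneg (v : Vec n → Vec n) (P Q : Vec n) : 0 ≤ segAvg v P Q :=
  integral_nonneg fun _ => norm_nonneg _

theorem abs_inner_sub_le {v : Vec n → Vec n} (hv : ContDiff ℝ 1 v) (P Q : Vec n) :
    |inner ℝ (v Q - v P) (Q - P)| ≤ ‖Q - P‖ ^ 2 * segAvg v P Q := by
  have hcd := hv.continuous_fderiv one_ne_zero
  have hcs := continuous_symGrad hv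
  have hd : ∀ t : ℝ, HasDerivAt (fun t : ℝ => inner ℝ (v (P + t • (Q - P))) (Q - P))
      (inner ℝ (fderiv ℝ v (P + t • (Q - P)) (Q - P)) (Q - P)) t := by
    intro t
    have h1 : HasDerivAt (fun t : ℝ => P + t • (Q - P)) (Q - P) t := by
      simpa using ((hasDerivAt_id t).smul_const (Q - P)).const_add P
    have h2 := ((hv.differentiable one_ne_zero) (P + t • (Q - P))).hasFDerivAt.comp_hasDerivAt t h1
    simpa using h2.inner ℝ (hasDerivAt_const t (Q - P))
  have hint := intervalIntegral.integral_eq_sub_of_hasDerivAt (a := 0) (b := 1)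
    (fun t _ => hd t) (Continuous.intervalIntegrable (by fun_prop) _ _)
  have he : inner ℝ (v Q - v P) (Q - P) =
      ∫ t in (0 : ℝ)..1, inner ℝ (fderiv ℝ v (P + t • (Q - P)) (Q - P)) (Q - P) := by
    rw [hint, ← inner_sub_left]; simp
  rw [he, segAvg, integral_Icc_eq_integral_Ioc, ← intervalIntegral.integral_of_le zero_le_one,
    ← intervalIntegral.integral_const_mul]
  refine (intervalIntegral.abs_integral_le_integral_abs zero_le_one).trans ?_
  refine intervalIntegral.integral_mono_on zero_le_one
    (Continuous.intervalIntegrable (by fun_prop) _ _)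
    (Continuous.intervalIntegrable (by fun_prop) _ _) fun t _ => abs_inner_fderiv_le _ _ _

theorem setLIntegral_comp_add_le {Ω Ω' : Set (Vec n)} (hΩ' : MeasurableSet Ω') (z : Vec n)
    (hz : ∀ x ∈ Ω, x + z ∈ Ω') {F : Vec n → ℝ≥0∞} (hF : Measurable F) :
    ∫⁻ x in Ω, F (x + z) ≤ ∫⁻ x in Ω', F x := by
  rw [← (measurePreserving_add_right volume z).setLIntegral_comp_preimage hΩ' hF]
  exact lintegral_mono_set hz

/-- Jensen puts `V` under the mean over the segment. After Tonelli, each point of the segment is a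
fixed translate of `x` by a vector in the `ε`-ball, which is convex. -/
theorem lintegral_segAvg_le {v : Vec n → Vec n} (hv : ContDiff ℝ 1 v) {Ω Ω' : Set (Vec n)}
    (hΩ' : MeasurableSet Ω') {ε : ℝ} (hsub : ∀ x ∈ Ω, Metric.closedBall x ε ⊆ Ω') {p q : Vec n}
    (hp : ‖p‖ ≤ ε) (hq : ‖q‖ ≤ ε) :
    ∫⁻ x in Ω, ENNReal.ofReal (refV (segAvg v (x + p) (x + q))) ≤
      ∫⁻ x in Ω', ENNReal.ofReal (refV (symGrad v x)) := by
  have hcs := continuous_symGrad hv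
  have hVs : Continuous fun x => refV (symGrad v x) := continuous_refV.comp hcs
  have hprob : IsProbabilityMeasure (volume.restrict (Set.Icc (0 : ℝ) 1)) := ⟨by simp⟩
  calc ∫⁻ x in Ω, ENNReal.ofReal (refV (segAvg v (x + p) (x + q)))
      ≤ ∫⁻ x in Ω, ∫⁻ t in Set.Icc (0 : ℝ) 1,
          ENNReal.ofReal (refV (symGrad v (x + (p + t • (q - p))))) := by
        refine lintegral_mono fun x => ?_
        refine (ofReal_refV_integral_le _ _).trans_eq ?_
        refine lintegral_congr fun t => ?_
        rw [refV_norm]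
        rw [show x + (p + t • (q - p)) = x + p + t • (x + q - (x + p)) by module]
    _ = ∫⁻ t in Set.Icc (0 : ℝ) 1, ∫⁻ x in Ω,
          ENNReal.ofReal (refV (symGrad v (x + (p + t • (q - p))))) := by
        refine lintegral_lintegral_swap (Continuous.measurable ?_).aemeasurable
        unfold Function.uncurry
        refine ENNReal.continuous_ofReal.comp (hVs.comp ?_)
        fun_prop
    _ ≤ ∫⁻ _t in Set.Icc (0 : ℝ) 1, ∫⁻ x in Ω', ENNReal.ofReal (refV (symGrad v x)) := by
        refine setLIntegral_mono measurable_const fun t ht => ?_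
        refine setLIntegral_comp_add_le (F := fun x => ENNReal.ofReal (refV (symGrad v x))) hΩ' _
          (fun x hx => hsub x hx ?_) hVs.measurable.ennreal_ofReal
        have h1 : ‖p + t • (q - p)‖ ≤ ε := by
          have : p + t • (q - p) = (1 - t) • p + t • q := by module
          rw [this]
          refine (norm_add_le _ _).trans ?_
          rw [norm_smul, norm_smul, Real.norm_of_nonneg ht.1,
            Real.norm_of_nonneg (sub_nonneg.2 ht.2)]
          nlinarith [mul_le_mul_of_nonneg_left hp (sub_nonneg.2 ht.2),
            mul_le_mul_of_nonneg_left hq ht.1]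
        simpa [Metric.mem_closedBall, dist_eq_norm] using h1
    _ = _ := by simp

/-- Start points, relative to the centre, of the segments used to control the component in
direction `w` of a second difference in direction `y`. -/
def rhombusStart (w : Vec n) : Fin 6 → Vec n := ![-w, w, -w, w, 0, 0]

/-- End points, relative to the centre, of the segments used to control the component in
direction `w` of a second difference in direction `y`. -/
def rhombusEnd (y w : Vec n) : Fin 6 → Vec n := ![y, y, -y, -y, w, -w]

theorem norm_rhombusStart_le {w : Vec n} {ε : ℝ} (hε : 0 ≤ ε) (hw : ‖w‖ ≤ ε) (k : Fin 6) :
    ‖rhombusStart w k‖ ≤ ε := by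
  fin_cases k <;> simp [rhombusStart, hw, hε]

theorem norm_rhombusEnd_le {y w : Vec n} {ε : ℝ} (hy : ‖y‖ ≤ ε) (hw : ‖w‖ ≤ ε) (k : Fin 6) :
    ‖rhombusEnd y w k‖ ≤ ε := by
  fin_cases k <;> simp [rhombusEnd, hw, hy]

/-- The four sides joining `±w` to `±y` combine to `2⟨v(x+y) + v(x-y) - v(x+w) - v(x-w), w⟩`. The
two segments from the centre to `±w` replace the last two values by `-2v(x)`. -/
theorem inner_secondDiff_eq (v : Vec n → Vec n) (x y w : Vec n) :
    2 * inner ℝ (v (x + y) + v (x - y) - (2 : ℝ) • v x) w =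
      inner ℝ (v (x + y) - v (x + -w)) ((x + y) - (x + -w)) -
      inner ℝ (v (x + y) - v (x + w)) ((x + y) - (x + w)) -
      inner ℝ (v (x + -y) - v (x + w)) ((x + -y) - (x + w)) +
      inner ℝ (v (x + -y) - v (x + -w)) ((x + -y) - (x + -w)) +
      2 * inner ℝ (v (x + w) - v (x + 0)) ((x + w) - (x + 0)) -
      2 * inner ℝ (v (x + -w) - v (x + 0)) ((x + -w) - (x + 0)) := by
  simp only [add_sub_add_left_eq_sub, add_zero, ← sub_eq_add_neg,
    add_sub_cancel_left, inner_add_left, inner_sub_left, inner_add_right, inner_sub_right,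
    inner_smul_left, sub_sub_cancel_left, inner_neg_right, conj_trivial]
  ring

theorem abs_inner_secondDiff_le {v : Vec n → Vec n} (hv : ContDiff ℝ 1 v) (x : Vec n)
    {y w : Vec n} {ε : ℝ} (hy : ‖y‖ ≤ ε) (hw : ‖w‖ ≤ ε) :
    |inner ℝ (v (x + y) + v (x - y) - (2 : ℝ) • v x) w| ≤
      2 * ε ^ 2 * ∑ k, segAvg v (x + rhombusStart w k) (x + rhombusEnd y w k) := by
  have hε : 0 ≤ ε := (norm_nonneg y).trans hy
  have hedge : ∀ a b : Vec n, ∀ δ : ℝ, ‖b - a‖ ≤ δ →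
      |inner ℝ (v (x + b) - v (x + a)) ((x + b) - (x + a))| ≤
        δ ^ 2 * segAvg v (x + a) (x + b) := by
    intro a b δ h
    refine (abs_inner_sub_le hv _ _).trans ?_
    rw [add_sub_add_left_eq_sub]
    exact mul_le_mul_of_nonneg_right (by gcongr) (segAvg_nonneg _ _ _)
  have h2 : ∀ a b : Vec n, ‖a‖ ≤ ε → ‖b‖ ≤ ε → ‖b - a‖ ≤ 2 * ε := fun a b ha hb =>
    (norm_sub_le _ _).trans (by linarith)
  have hy' : ‖-y‖ ≤ ε := by rwa [norm_neg]
  have hw' : ‖-w‖ ≤ ε := by rwa [norm_neg]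
  have e1 := hedge (-w) y _ (h2 _ _ hw' hy)
  have e2 := hedge w y _ (h2 _ _ hw hy)
  have e3 := hedge (-w) (-y) _ (h2 _ _ hw' hy')
  have e4 := hedge w (-y) _ (h2 _ _ hw hy')
  have e5 := hedge 0 w ε (by simpa using hw)
  have e6 := hedge 0 (-w) ε (by simpa using hw)
  have key := inner_secondDiff_eq v x y w
  simp only [Fin.sum_univ_six, rhombusStart, rhombusEnd, Matrix.cons_val]
  -- In the identity for twice the component, a side, of length at most `2ε`, has weight `4ε²`, and
  -- a segment from the centre has weight `2ε²`. Nonnegativity allows raising the latter to `4ε²`,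
  -- giving a common factor.
  have s5 := mul_nonneg (sq_nonneg ε) (segAvg_nonneg v (x + 0) (x + w))
  have s6 := mul_nonneg (sq_nonneg ε) (segAvg_nonneg v (x + 0) (x + -w))
  rw [abs_le] at *
  constructor <;> nlinarith

theorem norm_secondDiff_le {v : Vec n → Vec n} (hv : ContDiff ℝ 1 v) (x : Vec n)
    {y : Vec n} {ε : ℝ} (hε : 0 < ε) (hy : ‖y‖ ≤ ε) :
    ‖v (x + y) + v (x - y) - (2 : ℝ) • v x‖ ≤
      2 * ε * ∑ p : Fin n × Fin 6, segAvg v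
        (x + rhombusStart (EuclideanSpace.single p.1 ε) p.2)
        (x + rhombusEnd y (EuclideanSpace.single p.1 ε) p.2) := by
  set D := v (x + y) + v (x - y) - (2 : ℝ) • v x with hD
  have h1 : ‖D‖ ≤ ∑ i, |D i| := by
    rw [EuclideanSpace.norm_eq]
    refine Real.sqrt_le_iff.2 ⟨by positivity, ?_⟩
    simpa using Finset.sum_sq_le_sq_sum_of_nonneg (s := Finset.univ) (f := fun i => |D i|)
      (fun i _ => abs_nonneg _)
  refine h1.trans ?_
  rw [Fintype.sum_prod_type, Finset.mul_sum]
  refine Finset.sum_le_sum fun i _ => ?_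
  have h := abs_inner_secondDiff_le hv x hy (w := EuclideanSpace.single i ε)
    (by simp [abs_of_pos hε])
  rw [← hD, EuclideanSpace.inner_single_right, conj_trivial, abs_mul, abs_of_pos hε] at h
  refine le_of_mul_le_mul_left ?_ hε
  linarith

theorem lintegral_secondDiff_le {v : Vec n → Vec n} (hn : 1 ≤ n) (hv : ContDiff ℝ 1 v)
    {Ω Ω' : Set (Vec n)}
    (hΩ' : MeasurableSet Ω') {ε L : ℝ} (hε : 0 < ε) (hL : 0 < L)
    (hsub : ∀ x ∈ Ω, Metric.closedBall x ε ⊆ Ω') {y : Vec n} (hy : ‖y‖ ≤ ε) :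
    ∫⁻ x in Ω, ENNReal.ofReal (refV ((L / 2) • (v (x + y) + v (x - y) - (2 : ℝ) • v x))) ≤
      ENNReal.ofReal (216 * n ^ 3 * max (L * ε) ((L * ε) ^ 2)) *
        ∫⁻ x in Ω', ENNReal.ofReal (refV (symGrad v x)) := by
  set S : Fin n × Fin 6 → Vec n → ℝ := fun p x => segAvg v
        (x + rhombusStart (EuclideanSpace.single p.1 ε) p.2)
        (x + rhombusEnd y (EuclideanSpace.single p.1 ε) p.2) with hS
  have hS0 : ∀ p x, 0 ≤ S p x := fun p x => segAvg_nonneg _ _ _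
  set M := max (L * ε) ((L * ε) ^ 2)
  have hM0 : 0 ≤ M := le_max_of_le_left (by positivity)
  have hn' : (1 : ℝ) ≤ n := by exact_mod_cast hn
  -- Distributing `V` over the `6n` segment means multiplies each argument by `6n`; the scaling
  -- bound for `V` then costs at most `36 n²`.
  have hmax : max (6 * n * (L * ε)) ((6 * n * (L * ε)) ^ 2) ≤ 36 * n ^ 2 * M := by
    have a1 : L * ε ≤ M := le_max_left _ _
    have a2 : (L * ε) ^ 2 ≤ M := le_max_right _ _
    have a3 : (6 * n : ℝ) ≤ 36 * n ^ 2 := by nlinarith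
    refine max_le ?_ ?_
    · gcongr
    · calc (6 * n * (L * ε)) ^ 2 = 36 * n ^ 2 * (L * ε) ^ 2 := by ring
        _ ≤ _ := by gcongr
  have hpt : ∀ x, refV ((L / 2) • (v (x + y) + v (x - y) - (2 : ℝ) • v x)) ≤
      ∑ p, 36 * n ^ 2 * M * refV (S p x) := by
    intro x
    have h1 : ‖(L / 2) • (v (x + y) + v (x - y) - (2 : ℝ) • v x)‖ ≤
        ‖∑ p, L * ε * S p x‖ := by
      rw [norm_smul, Real.norm_of_nonneg (by positivity), Real.norm_of_nonneg
        (Finset.sum_nonneg fun p _ => mul_nonneg (by positivity) (hS0 p x)), ← Finset.mul_sum]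
      have := mul_le_mul_of_nonneg_left (norm_secondDiff_le hv x hε hy)
        (show 0 ≤ L / 2 by positivity)
      refine this.trans_eq ?_
      simp only [hS]
      ring
    refine (refV_mono h1).trans ((refV_sum_le _ fun p =>
      mul_nonneg (by positivity) (hS0 p x)).trans ?_)
    refine Finset.sum_le_sum fun p _ => ?_
    have h2 : ((Fintype.card (Fin n × Fin 6) : ℕ) : ℝ) * (L * ε * S p x) =
        (6 * n * (L * ε)) • S p x := by
      simp only [Fintype.card_prod, Fintype.card_fin, Nat.cast_mul, Nat.cast_ofNat, smul_eq_mul]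
      ring
    rw [h2]
    exact (refV_smul_le (by positivity) _).trans
      (mul_le_mul_of_nonneg_right hmax (refV_nonneg _))
  have hcont : ∀ p, Continuous (S p) := by
    intro p
    have hcs := continuous_symGrad hv
    simp only [hS, segAvg, integral_Icc_eq_integral_Ioc,
      ← intervalIntegral.integral_of_le zero_le_one]
    refine intervalIntegral.continuous_parametric_intervalIntegral_of_continuous' ?_ 0 1
    unfold Function.uncurry
    fun_prop
  calc _ ≤ ∫⁻ x in Ω, ∑ p, ENNReal.ofReal (36 * n ^ 2 * M) * ENNReal.ofReal (refV (S p x)) := by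
        refine lintegral_mono fun x => ?_
        refine (ENNReal.ofReal_le_ofReal (hpt x)).trans_eq ?_
        rw [ENNReal.ofReal_sum_of_nonneg fun p _ => mul_nonneg (by positivity) (refV_nonneg _)]
        exact Finset.sum_congr rfl fun p _ => ENNReal.ofReal_mul (by positivity)
    _ = ∑ p, ENNReal.ofReal (36 * n ^ 2 * M) * ∫⁻ x in Ω, ENNReal.ofReal (refV (S p x)) := by
        have hm : ∀ p, Measurable fun x => ENNReal.ofReal (refV (S p x)) := fun p =>
          ((continuous_refV.comp (hcont p)).measurable).ennreal_ofReal
        rw [lintegral_finsetSum _ fun p _ => (hm p).const_mul _]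
        exact Finset.sum_congr rfl fun p _ => lintegral_const_mul _ (hm p)
    _ ≤ ∑ _p : Fin n × Fin 6, ENNReal.ofReal (36 * n ^ 2 * M) *
          ∫⁻ x in Ω', ENNReal.ofReal (refV (symGrad v x)) := by
        refine Finset.sum_le_sum fun p _ => ?_
        refine mul_le_mul' le_rfl ?_
        have hw : ‖(EuclideanSpace.single p.1 ε : Vec n)‖ ≤ ε := by simp [abs_of_pos hε]
        exact lintegral_segAvg_le hv hΩ' hsub (norm_rhombusStart_le hε.le hw p.2)
          (norm_rhombusEnd_le hy hw p.2)
    -- The `6n` equal summands with factor `36 n²` give `216 n³`.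
    _ = _ := by
        rw [Finset.sum_const, nsmul_eq_mul, ← mul_assoc]
        congr 1
        rw [← ENNReal.ofReal_natCast, ← ENNReal.ofReal_mul (by positivity)]
        congr 1
        simp only [Finset.card_univ, Fintype.card_prod, Fintype.card_fin, Nat.cast_mul,
          Nat.cast_ofNat]
        ring

/-! ### The estimate for `C¹` fields -/

section Mollifier

variable {ρ : Vec n → ℝ} {ε : ℝ}

theorem IsStandardMollifier.rescale_nonneg (hρ : IsStandardMollifier ρ) (hε : 0 < ε) (x : Vec n) : 0 ≤ rescale ρ ε x :=
  mul_nonneg (by positivity) (hρ.nonneg _)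

theorem IsStandardMollifier.rescale_neg (hρ : IsStandardMollifier ρ) (x : Vec n) : rescale ρ ε (-x) = rescale ρ ε x := by
  unfold rescale
  rw [hρ.radial (ε⁻¹ • -x) (ε⁻¹ • x) (by simp)]

theorem IsStandardMollifier.integral_rescale (hρ : IsStandardMollifier ρ) (hε : 0 < ε) : ∫ x, rescale ρ ε x = 1 := by
  unfold rescale
  rw [integral_const_mul, Measure.integral_comp_inv_smul, hρ.integral_eq_one]
  simp only [finrank_euclideanSpace, Fintype.card_fin, smul_eq_mul, mul_one]
  rw [abs_of_pos (by positivity), inv_mul_cancel₀ (by positivity)]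

theorem IsStandardMollifier.integrable_rescale (hρ : IsStandardMollifier ρ) (hε : 0 < ε) : Integrable (rescale ρ ε) := by
  by_contra h
  exact zero_ne_one ((integral_undef h).symm.trans (hρ.integral_rescale hε))

theorem IsStandardMollifier.rescale_eq_zero (hρ : IsStandardMollifier ρ) (hε : 0 < ε) {x : Vec n} (hx : ε < ‖x‖) : rescale ρ ε x = 0 := by
  have : ε⁻¹ • x ∉ tsupport ρ := fun h => by
    have h1 := hρ.tsupport_subset h
    rw [mem_closedBall_zero_iff, norm_smul, norm_inv, Real.norm_of_nonneg hε.le,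
      inv_mul_le_iff₀ hε] at h1
    linarith
  rw [rescale, image_eq_zero_of_notMem_tsupport this, mul_zero]

theorem IsStandardMollifier.hasCompactSupport_rescale (hρ : IsStandardMollifier ρ) (hε : 0 < ε) : HasCompactSupport (rescale ρ ε) :=
  HasCompactSupport.intro (isCompact_closedBall 0 ε) fun x hx =>
    hρ.rescale_eq_zero hε (by simpa using hx)

/-- Evenness of `ρ_ε` allows averaging the convolution with its reflection `y ↦ -y`; unit mass
brings `v x` under the integral. -/
theorem IsStandardMollifier.sub_mollify_eq (hρ : IsStandardMollifier ρ) (hε : 0 < ε)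
    {v : Vec n → Vec n} (hv : Continuous v) (x : Vec n) :
    v x - mollify ρ ε v x =
      ∫ y, rescale ρ ε y • ((-(1 / 2) : ℝ) • (v (x + y) + v (x - y) - (2 : ℝ) • v x)) := by
  have hint : ∀ f : Vec n → Vec n, Continuous f → Integrable fun y => rescale ρ ε y • f y := by
    intro f hf
    have h := (hρ.hasCompactSupport_rescale hε).convolutionExists_left_of_continuous_right
      (ContinuousLinearMap.lsmul ℝ ℝ) (hρ.integrable_rescale hε).locallyIntegrable
      (hf.comp continuous_neg) 0
    simpa [ConvolutionExistsAt] using h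
  have h1 : mollify ρ ε v x = ∫ y, rescale ρ ε y • v (x - y) := rfl
  have h2 : mollify ρ ε v x = ∫ y, rescale ρ ε y • v (x + y) := by
    rw [h1, ← integral_neg_eq_self]
    simp only [hρ.rescale_neg, sub_neg_eq_add]
  have h3 : v x = ∫ y, rescale ρ ε y • v x := by
    rw [integral_smul_const, hρ.integral_rescale hε, one_smul]
  have e : ∀ y, rescale ρ ε y • ((-(1 / 2) : ℝ) • (v (x + y) + v (x - y) - (2 : ℝ) • v x)) =
      rescale ρ ε y • v x - ((1 / 2 : ℝ) • (rescale ρ ε y • v (x + y)) +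
        (1 / 2 : ℝ) • (rescale ρ ε y • v (x - y))) := fun y => by module
  simp_rw [e]
  have i1 := (hint (fun y => v (x + y)) (by fun_prop)).fun_smul (1 / 2 : ℝ)
  have i2 := (hint (fun y => v (x - y)) (by fun_prop)).fun_smul (1 / 2 : ℝ)
  have i3 := hint (fun _ => v x) (by fun_prop)
  rw [integral_sub i3 (i1.fun_add i2), integral_add i1 i2, integral_smul, integral_smul, ← h1, ← h2,
    ← h3]
  module

theorem IsStandardMollifier.lintegral_sub_mollify_le (hρ : IsStandardMollifier ρ) (hε : 0 < ε)
    (hn : 1 ≤ n) {v : Vec n → Vec n}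
    (hv : ContDiff ℝ 1 v) {Ω Ω' : Set (Vec n)} (hΩ' : MeasurableSet Ω') {L : ℝ} (hL : 0 < L)
    (hsub : ∀ x ∈ Ω, Metric.closedBall x ε ⊆ Ω') :
    ∫⁻ x in Ω, ENNReal.ofReal (refV (L • (v x - mollify ρ ε v x))) ≤
      ENNReal.ofReal (216 * n ^ 3 * max (L * ε) ((L * ε) ^ 2)) *
        ∫⁻ x in Ω', ENNReal.ofReal (refV (symGrad v x)) := by
  have hvc := hv.continuous
  have hi := hρ.integrable_rescale hε
  set K := ENNReal.ofReal (216 * n ^ 3 * max (L * ε) ((L * ε) ^ 2)) *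
        ∫⁻ x in Ω', ENNReal.ofReal (refV (symGrad v x))
  set D : Vec n → Vec n → Vec n := fun x y =>
    (L / 2) • (v (x + y) + v (x - y) - (2 : ℝ) • v x) with hD
  have hDc : Continuous (Function.uncurry D) := by
    simp only [hD]
    unfold Function.uncurry
    fun_prop
  have hDx : ∀ y, Continuous fun x => D x y := fun y => by simp only [hD]; fun_prop
  have hDy : ∀ x, Continuous (D x) := fun x => by simp only [hD]; fun_prop
  have hVD : Measurable fun p : Vec n × Vec n => ENNReal.ofReal (refV (Function.uncurry D p)) :=
    (continuous_refV.comp hDc).measurable.ennreal_ofReal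
  calc ∫⁻ x in Ω, ENNReal.ofReal (refV (L • (v x - mollify ρ ε v x)))
      ≤ ∫⁻ x in Ω, ∫⁻ y, ENNReal.ofReal (rescale ρ ε y) * ENNReal.ofReal (refV (D x y)) := by
        refine lintegral_mono fun x => ?_
        have h1 : refV (L • (v x - mollify ρ ε v x)) = refV (∫ y, rescale ρ ε y • D x y) := by
          have : -(L • (v x - mollify ρ ε v x)) = ∫ y, rescale ρ ε y • D x y := by
            rw [hρ.sub_mollify_eq hε hvc x, ← integral_smul, ← integral_neg]
            refine integral_congr_ae (ae_of_all _ fun y => ?_)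
            simp only [hD]
            module
          rw [← this]
          simp [refV]
        rw [h1]
        exact ofReal_refV_integral_smul_le _ (hρ.rescale_nonneg hε) (hρ.integral_rescale hε)
          (hDy x).aestronglyMeasurable
    _ = ∫⁻ y, ∫⁻ x in Ω, ENNReal.ofReal (rescale ρ ε y) * ENNReal.ofReal (refV (D x y)) := by
        refine lintegral_lintegral_swap ?_
        unfold Function.uncurry
        exact (hi.1.aemeasurable.ennreal_ofReal.comp_quasiMeasurePreserving
          Measure.quasiMeasurePreserving_snd).mul hVD.aemeasurable
    _ ≤ ∫⁻ y, ENNReal.ofReal (rescale ρ ε y) * K := by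
        refine lintegral_mono fun y => ?_
        have hm : Measurable fun x => ENNReal.ofReal (refV (D x y)) :=
          (continuous_refV.comp (hDx y)).measurable.ennreal_ofReal
        rw [lintegral_const_mul _ hm]
        rcases le_or_gt ‖y‖ ε with h | h
        · exact mul_le_mul' le_rfl (lintegral_secondDiff_le hn hv hΩ' hε hL hsub h)
        · simp [hρ.rescale_eq_zero hε h]
    _ = K := by
        rw [lintegral_mul_const'' _ hi.1.aemeasurable.ennreal_ofReal,
          ← ofReal_integral_eq_lintegral_ofReal hi (ae_of_all _ (hρ.rescale_nonneg hε)),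
          hρ.integral_rescale hε, ENNReal.ofReal_one, one_mul]

end Mollifier

/-! ### Smoothing does not increase `∫ V(Eu)` -/

section Smoothing

variable {φ : Vec n → ℝ} {u : Vec n → Vec n}

theorem fderiv_convolution_apply (hφ : ContDiff ℝ ∞ φ) (hc : HasCompactSupport φ)
    (hu : LocallyIntegrable u) (x : Vec n) (i j : Fin n) :
    Integrable (fun y => partialDeriv j φ (x - y) * u y i) ∧
    fderiv ℝ (φ ⋆[ContinuousLinearMap.lsmul ℝ ℝ, volume] u) x (EuclideanSpace.single j 1) i =
      ∫ y, partialDeriv j φ (x - y) * u y i := by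
  have h1 := hc.hasFDerivAt_convolution_left (ContinuousLinearMap.lsmul ℝ ℝ) (μ := volume)
    (hφ.of_le (by simp)) hu x
  have hex : Integrable fun y => ((ContinuousLinearMap.lsmul ℝ ℝ :
      ℝ →L[ℝ] Vec n →L[ℝ] Vec n).precompL (Vec n)) (fderiv ℝ φ (x - y)) (u y) :=
    ((hc.fderiv (𝕜 := ℝ)).convolutionExists_left _ (hφ.continuous_fderiv (by simp)) hu x
      ).integrable_swap
  have hex1 := hex.apply_continuousLinearMap (EuclideanSpace.single j (1 : ℝ))
  have hi := (EuclideanSpace.proj i : Vec n →L[ℝ] ℝ).integrable_comp hex1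
  rw [h1.fderiv, convolution_eq_swap, ContinuousLinearMap.integral_apply hex]
  refine ⟨by simpa [partialDeriv] using hi, ?_⟩
  have := (EuclideanSpace.proj i : Vec n →L[ℝ] ℝ).integral_comp_comm hex1
  simpa [partialDeriv] using this.symm

theorem partialDeriv_comp_const_sub (hφ : ContDiff ℝ ∞ φ) (x y : Vec n) (j : Fin n) :
    partialDeriv j (fun z => φ (x - z)) y = -partialDeriv j φ (x - y) := by
  have h := ((hφ.differentiable (by simp)) (x - y)).hasFDerivAt.comp y
    ((hasFDerivAt_id y).const_sub x)
  have h' : fderiv ℝ (fun z => φ (x - z)) y = _ := h.fderiv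
  simp [partialDeriv, h']

/-- The derivative falls on `φ`, and `y ↦ φ (x - y)` serves as test function for `Eu`; its reflected
argument cancels the sign of the distributional derivative. -/
theorem symGrad_convolution {μ : SymRadonMeasure n} (hφ : ContDiff ℝ ∞ φ)
    (hc : HasCompactSupport φ) (hu : LocallyIntegrable u) (hμ : IsSymGradient u μ) (x : Vec n)
    (i j : Fin n) :
    symGrad (φ ⋆[ContinuousLinearMap.lsmul ℝ ℝ, volume] u) x (i, j) =
      ∫ y, φ (x - y) * μ.polar y (i, j) ∂μ.tv := by
  have h := hμ (fun y => φ (x - y)) (by fun_prop)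
    (hc.comp_homeomorph (Homeomorph.subLeft x)) i j
  have h1 := fderiv_convolution_apply hφ hc hu x i j
  have h2 := fderiv_convolution_apply hφ hc hu x j i
  simp only [symGrad, h1.2, h2.2]
  rw [← neg_eq_iff_eq_neg] at h
  rw [← h, ← integral_add h1.1 h2.1, ← integral_div, ← integral_neg]
  refine integral_congr_ae (ae_of_all _ fun y => ?_)
  simp only [partialDeriv_comp_const_sub hφ]
  ring

theorem SymRadonMeasure.funInt_refV (μ : SymRadonMeasure n) (A : Set (Vec n)) :
    μ.funInt refV A =
      (∫⁻ x in A, ENNReal.ofReal (refV ((μ.tv.rnDeriv volume x).toReal • μ.polar x))) +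
        μ.tv.singularPart volume A := by
  have h : ∀ᵐ x ∂(μ.tv.singularPart volume), ‖μ.polar x‖ = 1 :=
    (Measure.singularPart_le _ _).absolutelyContinuous.ae_le μ.norm_polar
  unfold SymRadonMeasure.funInt
  congr 1
  rw [← setLIntegral_one]
  refine lintegral_congr_ae (ae_restrict_of_ae ?_)
  filter_upwards [h] with x hx
  rw [recession_refV, hx, ENNReal.ofReal_one]

/-- The convolution of `φ` with a matrix-valued Radon measure, split by Lebesgue decomposition. -/
theorem symGrad_convolution_eq {μ : SymRadonMeasure n} (hφ : ContDiff ℝ ∞ φ)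
    (hc : HasCompactSupport φ) (hu : LocallyIntegrable u) (hμ : IsSymGradient u μ) (x : Vec n) :
    symGrad (φ ⋆[ContinuousLinearMap.lsmul ℝ ℝ, volume] u) x =
      (∫ y, φ (x - y) • ((μ.tv.rnDeriv volume y).toReal • μ.polar y)) +
        ∫ y, φ (x - y) • μ.polar y ∂(μ.tv.singularPart volume) := by
  have := μ.locallyFinite
  have hcx : HasCompactSupport fun y => φ (x - y) := hc.comp_homeomorph (Homeomorph.subLeft x)
  have hφc := hφ.continuous
  have hint : Integrable (fun y => φ (x - y) • μ.polar y) μ.tv := by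
    have h0 : Integrable (fun y => φ (x - y)) μ.tv :=
      Continuous.integrable_of_hasCompactSupport (by fun_prop) hcx
    refine h0.norm.mono' (h0.1.smul μ.measurable_polar.aestronglyMeasurable) ?_
    filter_upwards [μ.norm_polar] with y hy
    rw [norm_smul, hy, mul_one]
  have h1 : symGrad (φ ⋆[ContinuousLinearMap.lsmul ℝ ℝ, volume] u) x =
      ∫ y, φ (x - y) • μ.polar y ∂μ.tv := by
    ext ⟨i, j⟩
    rw [symGrad_convolution hφ hc hu hμ]
    have := (EuclideanSpace.proj (i, j) : Mat n →L[ℝ] ℝ).integral_comp_comm hint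
    simpa using this
  have hdec := Measure.haveLebesgueDecomposition_add μ.tv volume
  rw [h1]
  conv_lhs => rw [hdec]
  rw [integral_add_measure, integral_withDensity_eq_integral_toReal_smul
    (Measure.measurable_rnDeriv _ _) (Measure.rnDeriv_lt_top _ _), add_comm]
  · congr 1
    refine integral_congr_ae (ae_of_all _ fun y => smul_comm _ _ _)
  · exact hint.mono_measure (Measure.singularPart_le _ _)
  · exact hint.mono_measure (Measure.withDensity_rnDeriv_le _ _)

/-- Tonelli: for `x ∈ A` only `y ∈ B` contribute, and integrating the kernel in `x` yields at most
`1`. The measure `ν` is general so as to cover both Lebesgue measure and the singular part. -/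
theorem lintegral_lintegral_convolution_le (ν : Measure (Vec n)) [SFinite ν] (hφ : Continuous φ)
    (hφ0 : ∀ x, 0 ≤ φ x) (hφ1 : ∫ x, φ x = 1) {η : ℝ} (hη : ∀ x, η < ‖x‖ → φ x = 0)
    {A B : Set (Vec n)} (hA : MeasurableSet A) (hB : MeasurableSet B)
    (hAB : ∀ x ∈ A, Metric.closedBall x η ⊆ B) {h : Vec n → ℝ≥0∞} (hh : Measurable h) :
    ∫⁻ x in A, ∫⁻ y, ENNReal.ofReal (φ (x - y)) * h y ∂ν ≤ ∫⁻ y in B, h y ∂ν := by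
  have hi : Integrable φ := by
    by_contra h
    exact zero_ne_one ((integral_undef h).symm.trans hφ1)
  have hm : Measurable fun p : Vec n × Vec n => ENNReal.ofReal (φ (p.1 - p.2)) :=
    Continuous.measurable (ENNReal.continuous_ofReal.comp (by fun_prop))
  calc ∫⁻ x in A, ∫⁻ y, ENNReal.ofReal (φ (x - y)) * h y ∂ν
      ≤ ∫⁻ x in A, ∫⁻ y in B, ENNReal.ofReal (φ (x - y)) * h y ∂ν := by
        refine setLIntegral_mono' hA fun x hx => ?_
        rw [← lintegral_indicator hB]
        refine lintegral_mono fun y => ?_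
        by_cases hy : y ∈ B
        · simp [hy]
        · have : φ (x - y) = 0 := hη _ <| lt_of_not_ge fun hle => hy <| hAB x hx <| by
            rwa [Metric.mem_closedBall', dist_eq_norm]
          simp [this]
    _ = ∫⁻ y in B, (∫⁻ x in A, ENNReal.ofReal (φ (x - y)) * h y) ∂ν := by
        refine lintegral_lintegral_swap ?_
        unfold Function.uncurry
        exact (hm.mul (hh.comp measurable_snd)).aemeasurable
    _ ≤ ∫⁻ y in B, h y ∂ν := by
        refine lintegral_mono fun y => ?_
        have hmy : Measurable fun x => ENNReal.ofReal (φ (x - y)) :=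
          hm.comp (measurable_id.prodMk measurable_const)
        rw [lintegral_mul_const _ hmy]
        refine mul_le_of_le_one_left' ((setLIntegral_le_lintegral _ _).trans_eq ?_)
        rw [lintegral_sub_right_eq_self (fun x => ENNReal.ofReal (φ x)) y,
          ← ofReal_integral_eq_lintegral_ofReal hi (ae_of_all _ hφ0), hφ1, ENNReal.ofReal_one]

/-- Mollification does not increase `∫ V(Eu)`, up to enlarging the set. -/
theorem lintegral_symGrad_convolution_le {μ : SymRadonMeasure n} (hφ : ContDiff ℝ ∞ φ)
    (hc : HasCompactSupport φ) (hφ0 : ∀ x, 0 ≤ φ x) (hφ1 : ∫ x, φ x = 1) {η : ℝ}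
    (hη : ∀ x, η < ‖x‖ → φ x = 0) (hu : LocallyIntegrable u) (hμ : IsSymGradient u μ)
    {A B : Set (Vec n)} (hA : MeasurableSet A) (hB : MeasurableSet B)
    (hAB : ∀ x ∈ A, Metric.closedBall x η ⊆ B) :
    ∫⁻ x in A, ENNReal.ofReal
        (refV (symGrad (φ ⋆[ContinuousLinearMap.lsmul ℝ ℝ, volume] u) x)) ≤
      μ.funInt refV B := by
  have := μ.locallyFinite
  set σ := μ.tv.singularPart volume
  have hσ1 : ∀ᵐ x ∂σ, ‖μ.polar x‖ = 1 :=
    (Measure.singularPart_le _ _).absolutelyContinuous.ae_le μ.norm_polar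
  set f : Vec n → Mat n := fun y => (μ.tv.rnDeriv volume y).toReal • μ.polar y
  have hfm : Measurable f :=
    (Measure.measurable_rnDeriv _ _).ennreal_toReal.smul μ.measurable_polar
  have hVf : Measurable fun y => ENNReal.ofReal (refV (f y)) :=
    (continuous_refV.measurable.comp hfm).ennreal_ofReal
  have hφc := hφ.continuous
  have hm : Measurable fun p : Vec n × Vec n => ENNReal.ofReal (φ (p.1 - p.2)) :=
    Continuous.measurable (ENNReal.continuous_ofReal.comp (by fun_prop))
  have hpt : ∀ x, ENNReal.ofReal
        (refV (symGrad (φ ⋆[ContinuousLinearMap.lsmul ℝ ℝ, volume] u) x)) ≤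
      (∫⁻ y, ENNReal.ofReal (φ (x - y)) * ENNReal.ofReal (refV (f y))) +
        ∫⁻ y, ENNReal.ofReal (φ (x - y)) * 1 ∂σ := by
    intro x
    rw [symGrad_convolution_eq hφ hc hu hμ]
    refine (ENNReal.ofReal_le_ofReal (refV_add_le _ _)).trans ?_
    rw [ENNReal.ofReal_add (refV_nonneg _) (norm_nonneg _)]
    refine add_le_add ?_ ?_
    · refine ofReal_refV_integral_smul_le volume (fun y => hφ0 (x - y)) ?_
        hfm.aestronglyMeasurable
      rw [integral_sub_left_eq_self, hφ1]
    · rw [ofReal_norm]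
      refine (enorm_integral_le_lintegral_enorm _).trans (lintegral_mono_ae ?_)
      filter_upwards [hσ1] with y hy
      rw [enorm_smul, ← ofReal_norm (μ.polar y), hy, ← ofReal_norm, Real.norm_of_nonneg (hφ0 _),
        ENNReal.ofReal_one]
  refine (lintegral_mono hpt).trans ?_
  rw [lintegral_add_left (Measurable.lintegral_prod_right'
    (f := fun p : Vec n × Vec n => ENNReal.ofReal (φ (p.1 - p.2)) * ENNReal.ofReal (refV (f p.2)))
    (hm.mul (hVf.comp measurable_snd))), SymRadonMeasure.funInt_refV, ← setLIntegral_one]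
  exact add_le_add
    (lintegral_lintegral_convolution_le _ hφc hφ0 hφ1 hη hA hB hAB hVf)
    (lintegral_lintegral_convolution_le _ hφc hφ0 hφ1 hη hA hB hAB measurable_const)

end Smoothing

/-! ### Convolution of a compactly supported integrable kernel with a locally integrable map -/

section Local

variable {E E' F : Type*} [NormedAddCommGroup E] [NormedSpace ℝ E] [NormedAddCommGroup E']
  [NormedSpace ℝ E'] [NormedAddCommGroup F] [NormedSpace ℝ F]
  {f : Vec n → E} {g : Vec n → E'} {ε : ℝ} (B : E →L[ℝ] E' →L[ℝ] F)

/-- On a ball, the convolution depends only on `g` in the `ε`-enlarged ball, so global statements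
for integrable maps apply to the truncated `g`. -/
theorem convolution_integrand_indicator (hf0 : ∀ x, ε < ‖x‖ → f x = 0) {x₀ x : Vec n} {r : ℝ}
    (hx : x ∈ Metric.ball x₀ r) (t : Vec n) :
    B (f t) ((Metric.closedBall x₀ (r + ε)).indicator g (x - t)) = B (f t) (g (x - t)) := by
  rcases le_or_gt ‖t‖ ε with h | h
  · rw [Set.indicator_of_mem]
    rw [Metric.mem_ball, dist_eq_norm] at hx
    rw [Metric.mem_closedBall, dist_eq_norm, show x - t - x₀ = (x - x₀) - t by abel]
    exact (norm_sub_le _ _).trans (by linarith)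
  · simp [hf0 t h]

theorem ae_convolutionExistsAt_of_locallyIntegrable (hf : Integrable f)
    (hf0 : ∀ x, ε < ‖x‖ → f x = 0) (hg : LocallyIntegrable g) :
    ∀ᵐ x, ConvolutionExistsAt f g x B volume := by
  have h : ∀ k : ℕ, ∀ᵐ x : Vec n, x ∈ Metric.ball (0 : Vec n) k →
      ConvolutionExistsAt f g x B volume := by
    intro k
    have hi : Integrable ((Metric.closedBall (0 : Vec n) (k + ε)).indicator g) :=
      (hg.integrableOn_isCompact (isCompact_closedBall _ _)).integrable_indicator
        Metric.isClosed_closedBall.measurableSet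
    filter_upwards [hf.ae_convolution_exists B hi] with x hx hxk
    simpa only [ConvolutionExistsAt, convolution_integrand_indicator B hf0 hxk] using hx
  filter_upwards [ae_all_iff.2 h] with x hx
  obtain ⟨k, hk⟩ := exists_nat_gt ‖x‖
  exact hx k (by simpa using hk)

theorem locallyIntegrable_convolution (hf : Integrable f)
    (hf0 : ∀ x, ε < ‖x‖ → f x = 0) (hg : LocallyIntegrable g) :
    LocallyIntegrable (f ⋆[B, volume] g) := by
  intro x₀
  refine ⟨Metric.ball x₀ 1, Metric.ball_mem_nhds _ one_pos, ?_⟩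
  have hi : Integrable ((Metric.closedBall x₀ (1 + ε)).indicator g) :=
    (hg.integrableOn_isCompact (isCompact_closedBall _ _)).integrable_indicator
      Metric.isClosed_closedBall.measurableSet
  refine (hf.integrable_convolution B hi).integrableOn.congr_fun (fun x hx => ?_)
    Metric.isOpen_ball.measurableSet
  simp only [convolution_def, convolution_integrand_indicator B hf0 hx]

end Local

/-- Associativity is used in both orders. The kernel `ρ_ε` is merely integrable, so its convolution
with `|u|` is available only almost everywhere, whereas every convolution with `φ` exists
everywhere. -/
theorem IsStandardMollifier.mollify_convolution {ρ : Vec n → ℝ} (hρ : IsStandardMollifier ρ)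
    {ε : ℝ} (hε : 0 < ε) {φ : Vec n → ℝ} (hφ : Continuous φ) (hc : HasCompactSupport φ)
    {u : Vec n → Vec n} (hu : LocallyIntegrable u) :
    mollify ρ ε (φ ⋆[ContinuousLinearMap.lsmul ℝ ℝ, volume] u) =
      φ ⋆[ContinuousLinearMap.lsmul ℝ ℝ, volume] mollify ρ ε u := by
  have hi := hρ.integrable_rescale hε
  have h0 : ∀ x, ε < ‖x‖ → rescale ρ ε x = 0 := fun x => hρ.rescale_eq_zero hε
  have h0' : ∀ x, ε < ‖x‖ → ‖rescale ρ ε x‖ = 0 := fun x hx => by rw [h0 x hx, norm_zero]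
  have hun : LocallyIntegrable fun x => ‖u x‖ := fun x => (hu x).norm
  have hcomm : rescale ρ ε ⋆[ContinuousLinearMap.mul ℝ ℝ, volume] φ =
      φ ⋆[ContinuousLinearMap.mul ℝ ℝ, volume] rescale ρ ε := by
    ext1 x
    rw [convolution_eq_swap, convolution_def]
    exact integral_congr_ae (ae_of_all _ fun t => mul_comm _ _)
  ext1 x
  have h1 := convolution_assoc (x₀ := x) (ContinuousLinearMap.mul ℝ ℝ)
    (ContinuousLinearMap.lsmul ℝ ℝ) (ContinuousLinearMap.lsmul ℝ ℝ)
    (ContinuousLinearMap.lsmul ℝ ℝ : ℝ →L[ℝ] Vec n →L[ℝ] Vec n)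
    (fun a b z => mul_smul a b z) hi.1 hφ.aestronglyMeasurable hu.aestronglyMeasurable
    (ae_of_all _ (hc.convolutionExists_right _ hi.locallyIntegrable hφ))
    (ae_of_all _ (hc.norm.convolutionExists_left _ hφ.norm hun))
    ((hρ.hasCompactSupport_rescale hε).norm.convolutionExists_left_of_continuous_right _
      hi.norm.locallyIntegrable (hc.norm.continuous_convolution_left _ hφ.norm hun) x)
  have h2 := convolution_assoc (x₀ := x) (ContinuousLinearMap.mul ℝ ℝ)
    (ContinuousLinearMap.lsmul ℝ ℝ) (ContinuousLinearMap.lsmul ℝ ℝ)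
    (ContinuousLinearMap.lsmul ℝ ℝ : ℝ →L[ℝ] Vec n →L[ℝ] Vec n)
    (fun a b z => mul_smul a b z) hφ.aestronglyMeasurable hi.1 hu.aestronglyMeasurable
    (ae_of_all _ (hc.convolutionExists_left _ hφ hi.locallyIntegrable))
    (ae_convolutionExistsAt_of_locallyIntegrable _ hi.norm h0' hun)
    (hc.norm.convolutionExists_left _ hφ.norm
      (locallyIntegrable_convolution _ hi.norm h0' hun) x)
  rw [hcomm] at h1
  exact h1.symm.trans h2

/-- A sequence of bump functions supported in balls of radius `δ / (k + 1)`. -/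
def shrinkingBump {δ : ℝ} (hδ : 0 < δ) (k : ℕ) : ContDiffBump (0 : Vec n) where
  rIn := δ / (k + 1) / 2
  rOut := δ / (k + 1)
  rIn_pos := by positivity
  rIn_lt_rOut := half_lt_self (by positivity)

theorem ae_tendsto_shrinkingBump {δ : ℝ} (hδ : 0 < δ) {g : Vec n → Vec n}
    (hg : LocallyIntegrable g) :
    ∀ᵐ x, Tendsto (fun k => ((shrinkingBump hδ k).normed volume
      ⋆[ContinuousLinearMap.lsmul ℝ ℝ, volume] g) x) atTop (𝓝 (g x)) := by
  refine ContDiffBump.ae_convolution_tendsto_right_of_locallyIntegrable (K := 2) ?_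
    (Eventually.of_forall fun k => ?_) hg
  · exact (tendsto_const_div_atTop_nhds_zero_nat δ).comp (tendsto_add_atTop_nat 1) |>.congr
      fun k => by simp [shrinkingBump]
  · exact (mul_div_cancel₀ _ two_ne_zero).ge

theorem lintegral_sub_mollify_le (hn : 1 ≤ n) {Ω : Set (Vec n)} {u : Vec n → Vec n}
    (hu : LocallyIntegrable u) {μ : SymRadonMeasure n} (hμ : IsSymGradient u μ) {ε L R : ℝ}
    (hε : 0 < ε) (hL : 0 < L) (hR : ε < R) {ρ : Vec n → ℝ} (hρ : IsStandardMollifier ρ) :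
    ∫⁻ x in Ω, ENNReal.ofReal (refV (L • (u x - mollify ρ ε u x))) ≤
      ENNReal.ofReal (216 * n ^ 3 * max (L * ε) ((L * ε) ^ 2)) *
        μ.funInt refV (closure (Ω + Metric.ball (0 : Vec n) R)) := by
  -- One `δ` puts the closed `ε`-ball into an open neighbourhood of `Ω`, which is measurable; the
  -- other makes room for the supports of the bumps.
  obtain ⟨δ, hδ, hδR⟩ : ∃ δ, 0 < δ ∧ ε + δ + δ < R := ⟨(R - ε) / 3, by linarith, by linarith⟩
  set φ : ℕ → Vec n → ℝ := fun k => (shrinkingBump hδ k).normed volume with hφ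
  set v : ℕ → Vec n → Vec n := fun k => φ k ⋆[ContinuousLinearMap.lsmul ℝ ℝ, volume] u with hv
  set K := ENNReal.ofReal (216 * n ^ 3 * max (L * ε) ((L * ε) ^ 2)) *
        μ.funInt refV (closure (Ω + Metric.ball (0 : Vec n) R))
  have hφs : ∀ k, ContDiff ℝ ∞ (φ k) := fun k => (shrinkingBump hδ k).contDiff_normed
  have hφc : ∀ k, HasCompactSupport (φ k) := fun k => (shrinkingBump hδ k).hasCompactSupport_normed
  have hφδ : ∀ k x, δ < ‖x‖ → φ k x = 0 := by
    intro k x hx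
    have : x ∉ Function.support (φ k) := by
      rw [hφ, ContDiffBump.support_normed_eq, mem_ball_zero_iff, not_lt]
      refine le_trans ?_ hx.le
      exact div_le_self hδ.le (by simp)
    simpa using this
  have hvs : ∀ k, ContDiff ℝ 1 (v k) := fun k =>
    ((hφc k).contDiff_convolution_left _ (hφs k) hu).of_le (by simp)
  have hmu : LocallyIntegrable (mollify ρ ε u) :=
    locallyIntegrable_convolution _ (hρ.integrable_rescale hε)
      (fun x => hρ.rescale_eq_zero hε) hu
  have hmv : ∀ k, mollify ρ ε (v k) =
      φ k ⋆[ContinuousLinearMap.lsmul ℝ ℝ, volume] mollify ρ ε u := fun k =>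
    hρ.mollify_convolution hε (hφs k).continuous (hφc k) hu
  have hmvc : ∀ k, Continuous (mollify ρ ε (v k)) := fun k => by
    rw [hmv k]
    exact (hφc k).continuous_convolution_left _ (hφs k).continuous hmu
  have hbound : ∀ k, ∫⁻ x in Ω, ENNReal.ofReal (refV (L • (v k x - mollify ρ ε (v k) x))) ≤ K := by
    intro k
    have hA : MeasurableSet (Ω + Metric.ball (0 : Vec n) (ε + δ)) :=
      (Metric.isOpen_ball.add_left).measurableSet
    refine (hρ.lintegral_sub_mollify_le hε hn (hvs k) hA hL fun x hx y hy => ?_).trans ?_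
    · refine Set.mem_add.2 ⟨x, hx, y - x, ?_, by abel⟩
      rw [mem_ball_zero_iff, ← dist_eq_norm]
      exact (Metric.mem_closedBall.1 hy).trans_lt (by linarith)
    · refine mul_le_mul' le_rfl ?_
      refine lintegral_symGrad_convolution_le (hφs k) (hφc k)
        (fun x => (shrinkingBump hδ k).nonneg_normed x) (shrinkingBump hδ k).integral_normed
        (hφδ k) hu hμ hA isClosed_closure.measurableSet fun x hx y hy => subset_closure ?_
      obtain ⟨a, ha, b, hb, rfl⟩ := Set.mem_add.1 hx
      refine Set.mem_add.2 ⟨a, ha, b + (y - (a + b)), ?_, by abel⟩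
      rw [mem_ball_zero_iff] at hb ⊢
      rw [Metric.mem_closedBall, dist_eq_norm] at hy
      exact (norm_add_le _ _).trans_lt (by linarith)
  have hlim : ∀ᵐ x, Tendsto
      (fun k => ENNReal.ofReal (refV (L • (v k x - mollify ρ ε (v k) x)))) atTop
      (𝓝 (ENNReal.ofReal (refV (L • (u x - mollify ρ ε u x))))) := by
    filter_upwards [ae_tendsto_shrinkingBump hδ hu, ae_tendsto_shrinkingBump hδ hmu] with x h1 h2
    have h2' : Tendsto (fun k => mollify ρ ε (v k) x) atTop (𝓝 (mollify ρ ε u x)) :=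
      h2.congr fun k => by rw [hmv k]
    exact ((ENNReal.continuous_ofReal.comp continuous_refV).tendsto _).comp
      ((h1.sub h2').const_smul L)
  calc ∫⁻ x in Ω, ENNReal.ofReal (refV (L • (u x - mollify ρ ε u x)))
      = ∫⁻ x in Ω, liminf
          (fun k => ENNReal.ofReal (refV (L • (v k x - mollify ρ ε (v k) x)))) atTop := by
        refine lintegral_congr_ae (ae_restrict_of_ae ?_)
        filter_upwards [hlim] with x hx using hx.liminf_eq.symm
    _ ≤ liminf (fun k =>
          ∫⁻ x in Ω, ENNReal.ofReal (refV (L • (v k x - mollify ρ ε (v k) x)))) atTop :=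
        lintegral_liminf_le fun k => (continuous_refV.comp
          (((hvs k).continuous.sub (hmvc k)).const_smul L)).measurable.ennreal_ofReal
    _ ≤ liminf (fun _ : ℕ => K) atTop := liminf_le_liminf (Eventually.of_forall hbound)
    _ = K := liminf_const K

end ConvPoincare

end

theorem proposition5p1 (n : ℕ) (hn : 1 ≤ n) (lam : ℝ) (hlam : 1 < lam) :
    ∃ c : ℝ, 0 < c ∧
      ∀ Ω : Set (ConvPoincare.Vec n), ConvPoincare.IsBoundedLipschitzDomain Ω →
      ∀ u : ConvPoincare.Vec n → ConvPoincare.Vec n, ConvPoincare.MemBDLoc u →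
      ∀ Eu : ConvPoincare.SymRadonMeasure n, ConvPoincare.IsSymGradient u Eu →
      ∀ ε L : ℝ, 0 < ε → 0 < L →
      ∀ ρ : ConvPoincare.Vec n → ℝ, ConvPoincare.IsStandardMollifier ρ →
        ∫⁻ x in Ω, ENNReal.ofReal
            (ConvPoincare.refV (L • (u x - ConvPoincare.mollify ρ ε u x))) ≤
          ENNReal.ofReal (c * max (L * ε) ((L * ε) ^ 2)) *
            Eu.funInt ConvPoincare.refV
              (closure (Ω + Metric.ball (0 : ConvPoincare.Vec n) (lam * Real.sqrt n * ε))) := by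
  -- The constant does not depend on `λ`, which serves only to make the radius `λ√n ε` strictly
  -- larger than `ε`.
  refine ⟨216 * n ^ 3, by positivity, fun Ω _ u hu Eu hEu ε L hε hL ρ hρ => ?_⟩
  have hsqrt : 1 ≤ Real.sqrt n := Real.one_le_sqrt.2 (by exact_mod_cast hn)
  have hR : ε < lam * Real.sqrt n * ε := lt_mul_of_one_lt_left hε (by nlinarith)
  exact ConvPoincare.lintegral_sub_mollify_le hn hu.1 hEu hε hL hR hρ
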